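/- Let $1\le s\le d$ and let $T$ be a rooted binary tree (every node has at most two children) whose nodes are the coordinates $1,\dots,d$. For a finite set $W\subset\mathbb{R}\setminus\{0\}$ of weights let $\mathcal{F}_W$ be the set of all $\beta\in\mathbb{R}^d$ whose support consists of $s$ nodes forming a connected subtree of $T$ that contains the root, and whose nonzero entries lie in $W$. Let $\bar\beta$ be uniformly distributed on $\mathcal{F}_W$, let $X\in\mathbb{R}^{n\times d}$ have i.i.d. $\mathcal{N}(0,1)$ entries and let $e\in\mathbb{R}^n$ have i.i.d. $\mathcal{N}(0,\sigma^2)$ entries, where $\bar\beta,X,e$ are independent. One observes $z=f(X\bar\beta+e)$ for a fixed measurable $f:\mathbb{R}^n\to\mathbb{R}^n$, and $\|\cdot\|$ is the Euclidean norm. Estimators are measurable, may be randomized (by a random variable independent of $\bar\beta,X,e$) and take values in $\mathbb{R}^d$. There are constants $\varepsilon\in(0,1)$ and $c>0$ such that for all $C_0>0$ and $\sigma>0$ the following hold, where $$W_d=\Big\{\tfrac{C_0\sigma\sqrt d}{\sqrt{2(1-\varepsilon)}},\ \tfrac{C_0\sigma\sqrt d}{\sqrt{2(1-\varepsilon)}}+\tfrac{C_0\sigma\sqrt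 d}{\sqrt{1-\varepsilon}}\Big\}.$$ 1. $\log|\mathcal{F}_{W_d}|\ge cs$ for all $1\le s\le d$ and all $T$. 2. Let $(s_k),(d_k),(n_k)$ be sequences with $1\le s_k\le d_k$ and $n_k=o(s_k)$ as $k\to\infty$. Then for all sufficiently large $k$, with $(s,d,n)=(s_k,d_k,n_k)$ and with $\bar\beta$ uniform on $\mathcal{F}_{W_d}$, we have $$\mathbb{P}\big(\|\bar\beta-\hat\beta\|\ge C\|e\|\big)\ge\tfrac1{10}$$ for every $T$, every $f$, every estimator $\hat\beta$ computed from the observations $z$, and every $0<C\le C_0$. 3. There are nonempty finite sets of weights $W_{d,s}\subset\mathbb{R}\setminus\{0\}$, depending only on $d,s,C_0,\sigma$, such that the conclusion of 2, with $\bar\beta$ uniform on $\mathcal{F}_{W_{d,s}}$, holds even for every estimator $\hat\beta$ computed from both $X$ and $z$. Hence a number of samples of order $s$ is necessary for tree sparsity. -/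

import Mathlib

open MeasureTheory ProbabilityTheory Filter

noncomputable section

namespace TreeSparsity

/-- `G` is a binary tree with root `r` whose nodes are the `d` coefficients: a tree in which every
node has at most two children (neighbours that are one step further away from the root). -/
structure IsBinaryTree {d : ℕ} (G : SimpleGraph (Fin d)) (r : Fin d) : Prop where
  isTree : G.IsTree
  children_le_two : ∀ v : Fin d, {w | G.Adj v w ∧ G.dist r w = G.dist r v + 1}.ncard ≤ 2

/-- The tree sparsity model: the supports with `s` nodes that form a connected subtree containing
the root (equivalently, a node of the support always comes with its parent). -/
def treeModel {d : ℕ} (G : SimpleGraph (Fin d)) (r : Fin d) (s : ℕ) : Set (Finset (Fin d)) :=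
  {S | S.card = s ∧ r ∈ S ∧ (G.induce (S : Set (Fin d))).Connected}

/-- The restricted ensemble: the vectors with a support in the tree model and with all entries
on the support taken from the set of weights `W` (always used with `0 ∉ W`). -/
def ensemble {d : ℕ} (G : SimpleGraph (Fin d)) (r : Fin d) (s : ℕ) (W : Finset ℝ) :
    Set (Fin d → ℝ) :=
  {β | ∃ S ∈ treeModel G r s, (∀ i, i ∉ S → β i = 0) ∧ ∀ i ∈ S, β i ∈ W}

/-- The two-point set of weights
`{C₀ σ √d / √(2(1-ε)), C₀ σ √d / √(2(1-ε)) + C₀ σ √d / √(1-ε)}`. -/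
def twoWeights (C₀ σ ε : ℝ) (d : ℕ) : Finset ℝ :=
  {C₀ * σ * √(d : ℝ) / √(2 * (1 - ε)),
    C₀ * σ * √(d : ℝ) / √(2 * (1 - ε)) + C₀ * σ * √(d : ℝ) / √(1 - ε)}

/-- The Euclidean norm. -/
def l2norm {m : ℕ} (v : Fin m → ℝ) : ℝ := ‖WithLp.toLp 2 v‖

/-- Law of an `n × d` design matrix with i.i.d. `N(0,1)` entries. -/
def designLaw (n d : ℕ) : Measure (Fin n → Fin d → ℝ) :=
  Measure.pi fun _ => Measure.pi fun _ => gaussianReal 0 1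

/-- Law of a noise vector with i.i.d. centred Gaussian entries of standard deviation `σ`. -/
def noiseLaw (n : ℕ) (σ : ℝ) : Measure (Fin n → ℝ) :=
  Measure.pi fun _ => gaussianReal 0 (σ ^ 2).toNNReal

/-- Joint law of `(β, X, e, u)`: the signal `β` uniform on `F`, the design matrix `X`, the noise `e`
and the internal randomness `u` of the recovery procedure, all independent. -/
def jointLaw {d : ℕ} (n : ℕ) (F : Set (Fin d → ℝ)) (σ : ℝ) {U : Type} [MeasurableSpace U]
    (ν : Measure U) : Measure ((Fin d → ℝ) × (Fin n → Fin d → ℝ) × (Fin n → ℝ) × U) :=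
  (uniformOn F).prod ((designLaw n d).prod ((noiseLaw n σ).prod ν))

/-- The observation `z = f (X β + e)`. -/
def observation {n d : ℕ} (f : (Fin n → ℝ) → (Fin n → ℝ)) (X : Fin n → Fin d → ℝ)
    (β : Fin d → ℝ) (e : Fin n → ℝ) : Fin n → ℝ :=
  f ((Matrix.of X).mulVec β + e)

/-- The probability of `‖β - est (X, z, u)‖ ≥ C ‖e‖` when `β` is uniform on `F`. -/
def failureProb {n d : ℕ} (F : Set (Fin d → ℝ)) (σ C : ℝ) (f : (Fin n → ℝ) → (Fin n → ℝ))
    {U : Type} [MeasurableSpace U] (ν : Measure U)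
    (est : (Fin n → Fin d → ℝ) × (Fin n → ℝ) × U → (Fin d → ℝ)) : ENNReal :=
  jointLaw n F σ ν {ω : (Fin d → ℝ) × (Fin n → Fin d → ℝ) × (Fin n → ℝ) × U |
    C * l2norm ω.2.2.1 ≤
      l2norm (ω.1 - est (ω.2.1, observation f ω.2.1 ω.1 ω.2.2.1, ω.2.2.2))}

end TreeSparsity

end

/-! Distinct signals of the ensemble are at distance at least `Δ`. Outside the event `T ≤ ‖e‖`,
which Chebyshev makes rare, success within `C‖e‖` puts the estimate closer than `Δ/2` to the signal,
so the success regions of different signals are disjoint. It remains to bound the sum of their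
probabilities by a small fraction of the number of signals, which is at least `|W|^s` since one
fixed support already gives that many (`pow_le_ncard_ensemble`).

If the decoder does not see `X`, the law of `X β + e` depends on `β` only through `‖β‖`. Signals of
equal norm share one law, so their success probabilities sum to at most 1; two weights allow at most
`s + 1` norms, against `2^s` signals (`sum_decoding_le_card_image`, `card_image_norm_ensemble_le`).

If the decoder sees `X`, fix `X` and the internal randomness. The observation has density at most
`(2σ)⁻ⁿ` and mostly lies in a cube of half-side `B`, so disjoint regions there carry total
probability at most `(B/σ)ⁿ` (`sum_decoding_le_volume`). With `m` grid weights, `m` polynomially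
comparable to the cube, this is `m^(5n)` against `m^s`. -/

noncomputable section

namespace TreeSparsity

/-! ### The Euclidean norm -/

section Norm

variable {m : ℕ}

lemma l2norm_sq (v : Fin m → ℝ) : l2norm v ^ 2 = ∑ i, v i ^ 2 := by
  simp [l2norm, EuclideanSpace.norm_sq_eq]

lemma l2norm_nonneg (v : Fin m → ℝ) : 0 ≤ l2norm v := norm_nonneg _

lemma abs_apply_le_l2norm (v : Fin m → ℝ) (i : Fin m) : |v i| ≤ l2norm v := by
  simpa [l2norm] using PiLp.norm_apply_le (WithLp.toLp 2 v) i

lemma l2norm_sub_comm (v w : Fin m → ℝ) : l2norm (v - w) = l2norm (w - v) := by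
  simp only [l2norm, WithLp.toLp_sub, norm_sub_rev]

lemma l2norm_sub_le (u v w : Fin m → ℝ) : l2norm (u - w) ≤ l2norm (u - v) + l2norm (v - w) := by
  simp only [l2norm, WithLp.toLp_sub]
  exact norm_sub_le_norm_sub_add_norm_sub _ _ _

@[fun_prop]
lemma measurable_l2norm : Measurable (l2norm : (Fin m → ℝ) → ℝ) := by
  unfold l2norm
  exact (WithLp.measurable_toLp 2 _).norm

end Norm

/-! ### Gaussian vectors: law of `X β`, tails, bounded density -/

section Gaussian

/-- The characteristic function factors over the independent coordinates, and the Gaussian exponents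
add up to the squared norm of `b`. -/
lemma map_dotProduct_pi_gaussianReal {d : ℕ} (b : Fin d → ℝ) :
    (Measure.pi fun _ : Fin d => gaussianReal 0 1).map (fun x => x ⬝ᵥ b) =
      gaussianReal 0 (∑ i, b i ^ 2).toNNReal := by
  have hm : Measurable fun x : Fin d → ℝ => x ⬝ᵥ b := by
    unfold dotProduct; fun_prop
  have : IsProbabilityMeasure
      ((Measure.pi fun _ : Fin d => gaussianReal 0 1).map (fun x => x ⬝ᵥ b)) :=
    Measure.isProbabilityMeasure_map hm.aemeasurable
  refine Measure.ext_of_charFun ?_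
  ext t
  rw [charFun_apply_real, integral_map hm.aemeasurable (by fun_prop), charFun_gaussianReal]
  have h1 : ∀ x : Fin d → ℝ, Complex.exp (t * ((x ⬝ᵥ b : ℝ) : ℂ) * Complex.I) =
      ∏ i, Complex.exp (((t * b i : ℝ) : ℂ) * (x i : ℂ) * Complex.I) := by
    intro x
    rw [← Complex.exp_sum]
    congr 1
    simp only [dotProduct, Complex.ofReal_sum, Complex.ofReal_mul, Finset.mul_sum, Finset.sum_mul]
    exact Finset.sum_congr rfl fun i _ => by ring
  simp_rw [h1]
  rw [integral_fintype_prod_eq_prod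
    (f := fun i (y : ℝ) => Complex.exp (((t * b i : ℝ) : ℂ) * (y : ℂ) * Complex.I))]
  simp_rw [← charFun_apply_real, charFun_gaussianReal]
  rw [← Complex.exp_sum]
  congr 1
  have h2 : (((∑ i, b i ^ 2).toNNReal : ℝ) : ℂ) = ∑ i, (b i : ℂ) ^ 2 := by
    rw [Real.coe_toNNReal _ (Finset.sum_nonneg fun i _ => sq_nonneg _)]
    push_cast; rfl
  rw [h2]
  simp only [Complex.ofReal_zero, mul_zero, zero_mul, zero_sub, NNReal.coe_one, Complex.ofReal_one,
    one_mul, Complex.ofReal_mul, Finset.sum_neg_distrib, Finset.sum_mul, Finset.sum_div]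
  congr 1
  exact Finset.sum_congr rfl fun i _ => by ring

lemma map_mulVec_designLaw {n d : ℕ} (b : Fin d → ℝ) :
    (designLaw n d).map (fun X => (Matrix.of X).mulVec b) =
      Measure.pi fun _ => gaussianReal 0 (∑ i, b i ^ 2).toNNReal := by
  have hm : Measurable fun x : Fin d → ℝ => x ⬝ᵥ b := by
    unfold dotProduct; fun_prop
  rw [← map_dotProduct_pi_gaussianReal b]
  have : IsProbabilityMeasure
      ((Measure.pi fun _ : Fin d => gaussianReal 0 1).map (fun x => x ⬝ᵥ b)) :=
    Measure.isProbabilityMeasure_map hm.aemeasurable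
  exact Measure.pi_map_pi (fun _ => hm.aemeasurable)

/-- Chebyshev's inequality for the Euclidean norm of a Gaussian vector. -/
lemma pi_gaussianReal_le_l2norm {n : ℕ} (v : NNReal) {t : ℝ} (ht : 0 < t) :
    (Measure.pi fun _ : Fin n => gaussianReal 0 v) {x | t ≤ l2norm x} ≤
      ENNReal.ofReal (n * v / t ^ 2) := by
  have h0 : {x : Fin n → ℝ | t ≤ l2norm x} ⊆
      {x | ENNReal.ofReal (t ^ 2) ≤ ENNReal.ofReal (l2norm x ^ 2)} := fun x hx =>
    ENNReal.ofReal_le_ofReal (pow_le_pow_left₀ ht.le hx 2)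
  refine (measure_mono h0).trans ?_
  have ht2 : ENNReal.ofReal (t ^ 2) ≠ 0 := by simpa using ht.ne'
  refine (meas_ge_le_lintegral_div (by fun_prop) ht2 ENNReal.ofReal_ne_top).trans ?_
  rw [ENNReal.ofReal_div_of_pos (by positivity)]
  refine ENNReal.div_le_div_right ?_ _
  simp_rw [l2norm_sq]
  simp_rw [ENNReal.ofReal_sum_of_nonneg (fun i _ => sq_nonneg _)]
  rw [lintegral_finsetSum _ (fun i _ => by fun_prop)]
  have h1 : ∀ i : Fin n, ∫⁻ x, ENNReal.ofReal (x i ^ 2)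
      ∂(Measure.pi fun _ : Fin n => gaussianReal 0 v) = v := by
    intro i
    rw [(measurePreserving_eval (fun _ : Fin n => gaussianReal 0 v) i).lintegral_comp
      (f := fun y : ℝ => ENNReal.ofReal (y ^ 2)) (by fun_prop)]
    have hint : Integrable (fun y : ℝ => y ^ 2) (gaussianReal 0 v) :=
      (memLp_id_gaussianReal 2).integrable_sq
    rw [← ofReal_integral_eq_lintegral_ofReal hint (ae_of_all _ fun y => sq_nonneg y)]
    have hv := variance_fun_id_gaussianReal (μ := 0) (v := v)
    rw [variance_of_integral_eq_zero (by fun_prop) (by simp)] at hv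
    rw [hv]; simp
  simp [h1, ENNReal.ofReal_mul]

/-- The density peaks at `1/√(2πσ²)`, and `2π ≥ 4`. The rounded constant `(2σ)⁻¹` later cancels the
factor 2 in the side `2B` of the cube. -/
lemma gaussianReal_le_smul_volume {σ : ℝ} (hσ : 0 < σ) :
    gaussianReal 0 (σ ^ 2).toNNReal ≤ ENNReal.ofReal (2 * σ)⁻¹ • (volume : Measure ℝ) := by
  have hv : (σ ^ 2).toNNReal ≠ 0 := by simpa using hσ.ne'
  rw [gaussianReal_of_var_ne_zero _ hv, ← withDensity_const]
  refine withDensity_mono (ae_of_all _ fun x => ENNReal.ofReal_le_ofReal ?_)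
  rw [gaussianPDFReal, Real.coe_toNNReal _ (sq_nonneg σ)]
  have h2 : 2 * σ ≤ √(2 * Real.pi * σ ^ 2) := by
    refine Real.le_sqrt_of_sq_le ?_
    nlinarith [Real.pi_gt_three, sq_nonneg σ]
  calc _ ≤ (√(2 * Real.pi * σ ^ 2))⁻¹ * 1 := by
        gcongr
        rw [Real.exp_le_one_iff]
        exact div_nonpos_of_nonpos_of_nonneg (by simpa using sq_nonneg x) (by positivity)
    _ ≤ _ := by
        rw [mul_one]
        exact inv_anti₀ (by positivity) h2

/-- The product measure comes from the largest outer measure dominated by the product on boxes, so a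
comparison on boxes suffices. -/
lemma pi_le_pi {ι : Type*} [Fintype ι] {α : ι → Type*} [∀ i, MeasurableSpace (α i)]
    {μ ν : ∀ i, Measure (α i)} [∀ i, SigmaFinite (μ i)] [∀ i, SigmaFinite (ν i)]
    (h : ∀ i, μ i ≤ ν i) : Measure.pi μ ≤ Measure.pi ν := by
  refine Measure.le_iff.2 fun s hs => ?_
  conv_rhs => rw [Measure.pi, toMeasure_apply _ _ hs]
  refine OuterMeasure.le_pi.2 (fun t _ => ?_) s
  change Measure.pi μ _ ≤ _
  rw [Measure.pi_pi]
  exact Finset.prod_le_prod' fun i _ => h i _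

lemma noiseLaw_le_smul_volume (n : ℕ) {σ : ℝ} (hσ : 0 < σ) :
    noiseLaw n σ ≤ ENNReal.ofReal (2 * σ)⁻¹ ^ n • (volume : Measure (Fin n → ℝ)) := by
  have hs : SigmaFinite (ENNReal.ofReal (2 * σ)⁻¹ • (volume : Measure ℝ)) :=
    inferInstanceAs (SigmaFinite ((2 * σ)⁻¹.toNNReal • (volume : Measure ℝ)))
  refine (pi_le_pi fun _ => gaussianReal_le_smul_volume hσ).trans_eq ?_
  refine Measure.pi_eq fun t _ => ?_
  simp [volume_pi, Finset.prod_mul_distrib]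

/-- The anticoncentration bound behind the volume argument: decoding regions inside a cube. -/
lemma sum_noiseLaw_preimage_le {n : ℕ} {σ B : ℝ} (hσ : 0 < σ) (hB : 0 ≤ B) {ι : Type*}
    (F : Finset ι) (a : ι → Fin n → ℝ) (H : ι → Set (Fin n → ℝ))
    (hm : ∀ i ∈ F, MeasurableSet (H i)) (hd : (F : Set ι).PairwiseDisjoint H)
    (hH : ∀ i ∈ F, ∀ y ∈ H i, ∀ j, |y j| ≤ B) :
    ∑ i ∈ F, noiseLaw n σ {e | a i + e ∈ H i} ≤ ENNReal.ofReal ((B / σ) ^ n) := by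
  set c := ENNReal.ofReal (2 * σ)⁻¹ ^ n
  calc ∑ i ∈ F, noiseLaw n σ {e | a i + e ∈ H i}
      ≤ ∑ i ∈ F, c * volume (H i) := by
        refine Finset.sum_le_sum fun i _ => (noiseLaw_le_smul_volume n hσ _).trans_eq ?_
        simp only [Measure.smul_apply, smul_eq_mul]
        congr 1
        exact measure_preimage_add volume (a i) (H i)
    _ = c * volume (⋃ i ∈ F, H i) := by
        rw [measure_biUnion_finset hd hm, Finset.mul_sum]
    _ ≤ c * volume (Set.Icc (fun _ : Fin n => -B) (fun _ => B)) := by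
        gcongr
        refine Set.iUnion₂_subset fun i hi y hy => ?_
        exact ⟨fun j => (abs_le.1 (hH i hi y hy j)).1, fun j => (abs_le.1 (hH i hi y hy j)).2⟩
    _ = _ := by
        rw [Real.volume_Icc_pi]
        simp only [Finset.prod_const, Finset.card_univ, Fintype.card_fin, c]
        rw [← mul_pow, ← ENNReal.ofReal_mul (by positivity), ← ENNReal.ofReal_pow (by
          have : 0 ≤ B - -B := by linarith
          positivity)]
        congr 2
        field_simp
        ring

end Gaussian

/-! ### Size and separation of the ensemble -/

section Ensemble

variable {d : ℕ} {G : SimpleGraph (Fin d)} {r : Fin d}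

/-- A connected set grows by one node at a time: a walk from the root to a node outside must cross
the boundary along some edge, whose far end is added. -/
lemma treeModel_nonempty (hG : G.Connected) {s : ℕ} (h1 : 1 ≤ s) (hd : s ≤ d) :
    (treeModel G r s).Nonempty := by
  induction s, h1 using Nat.le_induction with
  | base =>
    refine ⟨{r}, by simp, by simp, ?_⟩
    have : Subsingleton ((({r} : Finset (Fin d)) : Set (Fin d))) := by simp
    have : Nonempty ((({r} : Finset (Fin d)) : Set (Fin d))) := ⟨⟨r, by simp⟩⟩
    exact SimpleGraph.Connected.of_subsingleton
  | succ s h1 ih =>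
    obtain ⟨S, hS, hr, hc⟩ := ih (by omega)
    obtain ⟨v, hv⟩ : ∃ v, v ∉ S := by
      by_contra! h
      have : S = Finset.univ := Finset.eq_univ_iff_forall.2 h
      simp [this] at hS
      omega
    obtain ⟨p⟩ := hG.preconnected r v
    obtain ⟨e, -, he1, he2⟩ := p.exists_boundary_dart (S : Set (Fin d)) (by simpa) (by simpa)
    refine ⟨insert e.snd S, ?_, by simp [hr], ?_⟩
    · rw [Finset.card_insert_of_notMem (by simpa using he2), hS]
    · have h2 := SimpleGraph.induce_union_connected hc.preconnected
        (SimpleGraph.induce_pair_connected_of_adj e.adj).preconnected ⟨e.fst, he1, by simp⟩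
      have h3 : ((insert e.snd S : Finset (Fin d)) : Set (Fin d)) =
          (S : Set (Fin d)) ∪ {e.fst, e.snd} := by
        ext x
        have : e.fst ∈ S := by simpa using he1
        simp only [Finset.coe_insert, Set.mem_insert_iff, Finset.mem_coe, Set.mem_union,
          Set.mem_singleton_iff]
        grind
      rw [h3]
      exact h2

variable {s : ℕ} {W : Finset ℝ}

lemma apply_mem_insert_of_mem_ensemble {β : Fin d → ℝ} (hβ : β ∈ ensemble G r s W) (i : Fin d) :
    β i ∈ insert 0 W := by
  obtain ⟨S, -, h0, hW⟩ := hβ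
  by_cases hi : i ∈ S
  · exact Finset.mem_insert_of_mem (hW i hi)
  · simp [h0 i hi]

lemma ensemble_finite : (ensemble G r s W).Finite :=
  (Set.Finite.pi' fun _ : Fin d => (insert 0 W).finite_toSet).subset fun _ hβ i =>
    apply_mem_insert_of_mem_ensemble hβ i

lemma pow_le_ncard_ensemble (hG : G.Connected) (h1 : 1 ≤ s) (hd : s ≤ d) :
    W.card ^ s ≤ (ensemble G r s W).ncard := by
  classical
  obtain ⟨S, hS⟩ := treeModel_nonempty (r := r) hG h1 hd
  have hc : (Fintype.piFinset fun _ : S => W).card = W.card ^ s := by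
    simp [hS.1]
  rw [← hc, ← Set.ncard_coe_finset]
  refine Set.ncard_le_ncard_of_injOn (fun g i => if hi : i ∈ S then g ⟨i, hi⟩ else 0) ?_ ?_
    ensemble_finite
  · intro g hg
    have hg' : ∀ i, g i ∈ W := by simpa using hg
    exact ⟨S, hS, fun i hi => by simp [hi], fun i hi => by simpa [hi] using hg' _⟩
  · intro g _ g' _ h
    ext ⟨i, hi⟩
    simpa [hi] using congrFun h i

/-- A single differing coordinate already gives the distance. Including 0 among the values handles
signals with different supports. -/
lemma ensemble_separated {Δ : ℝ}
    (hW : ∀ a ∈ insert 0 W, ∀ b ∈ insert 0 W, a ≠ b → Δ ≤ |a - b|) :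
    (ensemble G r s W).Pairwise fun β β' => Δ ≤ l2norm (β - β') := by
  intro β hβ β' hβ' hne
  obtain ⟨i, hi⟩ := Function.ne_iff.1 hne
  exact (hW _ (apply_mem_insert_of_mem_ensemble hβ i) _
    (apply_mem_insert_of_mem_ensemble hβ' i) hi).trans (abs_apply_le_l2norm (β - β') i)

end Ensemble

/-! ### Sums of success probabilities over the signals -/

section Decoding

instance (n d : ℕ) : IsProbabilityMeasure (designLaw n d) := by
  unfold designLaw; infer_instance

instance (n : ℕ) (σ : ℝ) : IsProbabilityMeasure (noiseLaw n σ) := by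
  unfold noiseLaw; infer_instance

variable {n d : ℕ}

@[fun_prop]
lemma measurable_mulVec_add (β : Fin d → ℝ) :
    Measurable fun p : (Fin n → Fin d → ℝ) × (Fin n → ℝ) => (Matrix.of p.1).mulVec β + p.2 := by
  unfold Matrix.mulVec dotProduct
  refine measurable_pi_lambda _ fun i => ?_
  simp only [Pi.add_apply, Matrix.of_apply]
  fun_prop

@[fun_prop]
lemma measurable_mulVec_uncurry :
    Measurable fun p : (Fin d → ℝ) × (Fin n → Fin d → ℝ) => (Matrix.of p.2).mulVec p.1 := by
  unfold Matrix.mulVec dotProduct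
  refine measurable_pi_lambda _ fun i => ?_
  simp only [Matrix.of_apply]
  fun_prop

lemma pairwiseDisjoint_of_separated {F : Set (Fin d → ℝ)} {Δ : ℝ}
    (hF : F.Pairwise fun β β' => Δ ≤ l2norm (β - β')) {α : Type*} (h : α → Fin d → ℝ) :
    F.PairwiseDisjoint fun β => {a | l2norm (β - h a) < Δ / 2} := by
  intro β hβ β' hβ' hne
  refine Set.disjoint_left.2 fun a ha ha' => ?_
  have h1 := hF hβ hβ' hne
  have h2 := l2norm_sub_le β (h a) β'
  rw [l2norm_sub_comm (h a) β'] at h2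
  simp only [Set.mem_ofPred_eq] at ha ha'
  linarith

lemma sum_measure_le_one {α ι : Type*} [MeasurableSpace α] (μ : Measure α)
    [IsProbabilityMeasure μ] (F : Finset ι) (E : ι → Set α) (hm : ∀ i ∈ F, MeasurableSet (E i))
    (hd : (F : Set ι).PairwiseDisjoint E) : ∑ i ∈ F, μ (E i) ≤ 1 := by
  rw [← measure_biUnion_finset hd hm]
  exact prob_le_one

/-- Fubini: a bound uniform in the frozen variable survives averaging. It serves to freeze `X`, then
the internal randomness. -/
lemma sum_prod_le_of_forall {α γ ι : Type*} [MeasurableSpace α] [MeasurableSpace γ]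
    (μ : Measure α) [IsProbabilityMeasure μ] (ρ : Measure γ) [SFinite ρ] (F : Finset ι)
    (E : ι → Set (α × γ)) (hm : ∀ i ∈ F, MeasurableSet (E i)) {c : ENNReal}
    (h : ∀ a, ∑ i ∈ F, ρ (Prod.mk a ⁻¹' E i) ≤ c) : ∑ i ∈ F, (μ.prod ρ) (E i) ≤ c := by
  calc ∑ i ∈ F, (μ.prod ρ) (E i) = ∑ i ∈ F, ∫⁻ a, ρ (Prod.mk a ⁻¹' E i) ∂μ :=
        Finset.sum_congr rfl fun i hi => Measure.prod_apply (hm i hi)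
    _ = ∫⁻ a, ∑ i ∈ F, ρ (Prod.mk a ⁻¹' E i) ∂μ :=
        (lintegral_finsetSum' _ fun i hi =>
          (measurable_measure_prodMk_left (hm i hi)).aemeasurable).symm
    _ ≤ ∫⁻ _, c ∂μ := lintegral_mono h
    _ = c := by simp

lemma measurableSet_cube (B : ℝ) : MeasurableSet {y : Fin n → ℝ | ∀ j, |y j| ≤ B} := by
  simp only [Set.ofPred_forall]
  exact MeasurableSet.iInter fun j => measurableSet_le (by fun_prop) measurable_const

variable {U : Type} [MeasurableSpace U] (ν : Measure U) [IsProbabilityMeasure ν] (σ : ℝ)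

lemma measurableSet_failure {C : ℝ} {f : (Fin n → ℝ) → (Fin n → ℝ)} (hf : Measurable f)
    {est : (Fin n → Fin d → ℝ) × (Fin n → ℝ) × U → (Fin d → ℝ)} (hest : Measurable est) :
    MeasurableSet {ω : (Fin d → ℝ) × (Fin n → Fin d → ℝ) × (Fin n → ℝ) × U |
      C * l2norm ω.2.2.1 ≤
        l2norm (ω.1 - est (ω.2.1, observation f ω.2.1 ω.1 ω.2.2.1, ω.2.2.2))} := by
  unfold observation
  refine measurableSet_le (by fun_prop) (measurable_l2norm.comp ?_)
  refine measurable_fst.sub (hest.comp ?_)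
  refine Measurable.prodMk (by fun_prop) (Measurable.prodMk (hf.comp ?_) (by fun_prop))
  exact (measurable_mulVec_uncurry.comp
    (measurable_fst.prodMk (measurable_fst.comp measurable_snd))).add (by fun_prop)

/-- The failure probability is at least `1/10` once the success probabilities, summed over the
signals, are at most `9/10` of the number of signals. -/
lemma failureProb_ge {F : Set (Fin d → ℝ)} (hF : F.Finite) (hne : F.Nonempty) {C : ℝ}
    {f : (Fin n → ℝ) → (Fin n → ℝ)} (hf : Measurable f)
    {est : (Fin n → Fin d → ℝ) × (Fin n → ℝ) × U → (Fin d → ℝ)} (hest : Measurable est)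
    (h : ∑ β ∈ hF.toFinset, ((designLaw n d).prod ((noiseLaw n σ).prod ν))
      {p | l2norm (β - est (p.1, observation f p.1 β p.2.1, p.2.2)) < C * l2norm p.2.1} ≤
        ENNReal.ofReal (9 / 10 * F.ncard)) :
    1 / 10 ≤ failureProb F σ C f ν est := by
  have := isProbabilityMeasure_uniformOn hF hne
  set κ := (designLaw n d).prod ((noiseLaw n σ).prod ν)
  have hm := measurableSet_failure (U := U) (C := C) hf hest
  set A := {ω : (Fin d → ℝ) × (Fin n → Fin d → ℝ) × (Fin n → ℝ) × U |
      C * l2norm ω.2.2.1 ≤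
        l2norm (ω.1 - est (ω.2.1, observation f ω.2.1 ω.1 ω.2.2.1, ω.2.2.2))}
  change 1 / 10 ≤ ((uniformOn F).prod κ) A
  have hN : (F.ncard : ℝ) ≠ 0 := by
    exact_mod_cast (Set.ncard_pos hF).2 hne |>.ne'
  have hN' : (0 : ℝ) < F.ncard := lt_of_le_of_ne (by positivity) hN.symm
  have hA : ((uniformOn F).prod κ) Aᶜ ≤ ENNReal.ofReal (9 / 10) := by
    -- The uniform law is normalized counting measure, so the success probability is the sum in `h`
    -- divided by the number of signals.
    have h1 : ∫⁻ β in F, κ (Prod.mk β ⁻¹' Aᶜ) ∂Measure.count ≤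
        ENNReal.ofReal (9 / 10 * F.ncard) := by
      refine le_trans (le_of_eq ?_) h
      conv_lhs => rw [← hF.coe_toFinset, lintegral_finset]
      refine Finset.sum_congr rfl fun β _ => ?_
      rw [Measure.count_singleton, mul_one]
      congr 1
      ext p
      simp [A]
    rw [Measure.prod_apply hm.compl, uniformOn, ProbabilityTheory.cond, lintegral_smul_measure]
    have h2 : (Measure.count F : ENNReal) = ENNReal.ofReal F.ncard := by
      rw [Measure.count_apply_finite F hF, ENNReal.ofReal_natCast, Set.ncard_eq_toFinset_card F hF]
    rw [h2, smul_eq_mul, ← ENNReal.ofReal_inv_of_pos hN']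
    refine (mul_le_mul_right h1 _).trans ?_
    rw [← ENNReal.ofReal_mul (by positivity)]
    refine ENNReal.ofReal_le_ofReal (le_of_eq ?_)
    field_simp
  have h3 := prob_add_prob_compl (μ := (uniformOn F).prod κ) hm
  have h4 : (1 : ENNReal) ≤ ((uniformOn F).prod κ) A + ENNReal.ofReal (9 / 10) := by
    rw [← h3]; gcongr
  refine le_trans ?_ (tsub_le_iff_right.2 h4)
  rw [← ENNReal.ofReal_one, ← ENNReal.ofReal_sub _ (by norm_num)]
  rw [show (10 : ENNReal) = ENNReal.ofReal 10 by simp,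
    ← ENNReal.ofReal_div_of_pos (by norm_num)]
  exact ENNReal.ofReal_le_ofReal (by norm_num)

lemma measure_le_l2norm_noise {T : ℝ} (hT : 0 < T) :
    ((designLaw n d).prod ((noiseLaw n σ).prod ν)) {p | T ≤ l2norm p.2.1} ≤
      ENNReal.ofReal (n * σ ^ 2 / T ^ 2) := by
  have h1 : MeasurePreserving (fun p : (Fin n → Fin d → ℝ) × (Fin n → ℝ) × U => p.2.1)
      ((designLaw n d).prod ((noiseLaw n σ).prod ν)) (noiseLaw n σ) :=
    measurePreserving_fst.comp measurePreserving_snd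
  have h2 := h1.measure_preimage (s := {e | T ≤ l2norm e})
    (measurableSet_le measurable_const measurable_l2norm).nullMeasurableSet
  refine h2.trans_le ((pi_gaussianReal_le_l2norm _ hT).trans_eq ?_)
  rw [Real.coe_toNNReal _ (sq_nonneg σ)]

lemma measure_le_l2norm_mulVec (β : Fin d → ℝ) {R : ℝ} (hR : 0 < R) :
    ((designLaw n d).prod ((noiseLaw n σ).prod ν)) {p | R ≤ l2norm ((Matrix.of p.1).mulVec β)} ≤
      ENNReal.ofReal (n * (∑ i, β i ^ 2) / R ^ 2) := by
  have h0 : MeasurePreserving (fun X : Fin n → Fin d → ℝ => (Matrix.of X).mulVec β)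
      (designLaw n d) (Measure.pi fun _ => gaussianReal 0 (∑ i, β i ^ 2).toNNReal) :=
    ⟨measurable_mulVec_uncurry.comp measurable_prodMk_left, map_mulVec_designLaw β⟩
  have h1 := h0.comp (measurePreserving_fst (μ := designLaw n d) (ν := (noiseLaw n σ).prod ν))
  have h2 := h1.measure_preimage (s := {e | R ≤ l2norm e})
    (measurableSet_le measurable_const measurable_l2norm).nullMeasurableSet
  refine h2.trans_le ((pi_gaussianReal_le_l2norm _ hR).trans_eq ?_)
  rw [Real.coe_toNNReal _ (Finset.sum_nonneg fun i _ => sq_nonneg _)]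

/-- A decoder that does not see the design matrix only learns the norm of the signal. -/
lemma sum_decoding_le_card_image {F : Finset (Fin d → ℝ)} {Δ : ℝ}
    (hF : (F : Set (Fin d → ℝ)).Pairwise fun β β' => Δ ≤ l2norm (β - β'))
    {h : (Fin n → ℝ) × U → (Fin d → ℝ)} (hh : Measurable h) :
    ∑ β ∈ F, ((designLaw n d).prod ((noiseLaw n σ).prod ν))
      {p | l2norm (β - h ((Matrix.of p.1).mulVec β + p.2.1, p.2.2)) < Δ / 2} ≤
        (F.image fun β => ∑ i, β i ^ 2).card := by
  classical
  let ρ : ℝ → Measure ((Fin n → ℝ) × (Fin n → ℝ) × U) := fun v =>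
    (Measure.pi fun _ => gaussianReal 0 v.toNNReal).prod ((noiseLaw n σ).prod ν)
  let E : (Fin d → ℝ) → Set ((Fin n → ℝ) × (Fin n → ℝ) × U) := fun β =>
    {q | l2norm (β - h (q.1 + q.2.1, q.2.2)) < Δ / 2}
  have hE : ∀ β, MeasurableSet (E β) := fun β =>
    measurableSet_lt (measurable_l2norm.comp (measurable_const.sub (hh.comp (by fun_prop))))
      measurable_const
  have h1 : ∀ β ∈ F, ((designLaw n d).prod ((noiseLaw n σ).prod ν))
      {p | l2norm (β - h ((Matrix.of p.1).mulVec β + p.2.1, p.2.2)) < Δ / 2} =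
        ρ (∑ i, β i ^ 2) (E β) := by
    intro β _
    have h0 : MeasurePreserving (fun X : Fin n → Fin d → ℝ => (Matrix.of X).mulVec β)
        (designLaw n d) (Measure.pi fun _ => gaussianReal 0 (∑ i, β i ^ 2).toNNReal) :=
      ⟨measurable_mulVec_uncurry.comp measurable_prodMk_left, map_mulVec_designLaw β⟩
    exact (h0.prod (MeasurePreserving.id ((noiseLaw n σ).prod ν))).measure_preimage
      (hE β).nullMeasurableSet
  -- Group the signals by squared norm: within a fibre the measure `ρ v` is common and the events
  -- are disjoint, so each fibre contributes at most 1.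
  rw [Finset.sum_congr rfl h1, ← Finset.sum_fiberwise_of_maps_to (t := F.image _)
    (fun β hβ => Finset.mem_image_of_mem (fun β => ∑ i, β i ^ 2) hβ)]
  refine (Finset.sum_le_card_nsmul _ _ 1 fun v _ => ?_).trans_eq (by simp)
  rw [Finset.sum_congr rfl fun β hβ => by rw [(Finset.mem_filter.1 hβ).2]]
  refine sum_measure_le_one (ρ v) _ E (fun β _ => hE β) ?_
  exact (pairwiseDisjoint_of_separated hF
    (fun q : (Fin n → ℝ) × (Fin n → ℝ) × U => h (q.1 + q.2.1, q.2.2))).subset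
      (Finset.coe_subset.2 (Finset.filter_subset _ _))

/-- The volume argument: decoding from the design matrix and bounded observations. -/
lemma sum_decoding_le_volume {F : Finset (Fin d → ℝ)} {Δ : ℝ}
    (hF : (F : Set (Fin d → ℝ)).Pairwise fun β β' => Δ ≤ l2norm (β - β'))
    {h : (Fin n → Fin d → ℝ) × (Fin n → ℝ) × U → (Fin d → ℝ)} (hh : Measurable h)
    {σ B : ℝ} (hσ : 0 < σ) (hB : 0 ≤ B) :
    ∑ β ∈ F, ((designLaw n d).prod ((noiseLaw n σ).prod ν))
      {p | l2norm (β - h (p.1, (Matrix.of p.1).mulVec β + p.2.1, p.2.2)) < Δ / 2 ∧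
        ∀ j, |((Matrix.of p.1).mulVec β + p.2.1) j| ≤ B} ≤ ENNReal.ofReal ((B / σ) ^ n) := by
  have hy : ∀ β : Fin d → ℝ, Measurable fun p : (Fin n → Fin d → ℝ) × (Fin n → ℝ) × U =>
      (Matrix.of p.1).mulVec β + p.2.1 := fun β =>
    (measurable_mulVec_add β).comp (measurable_fst.prodMk (measurable_fst.comp measurable_snd))
  have hm : ∀ β : Fin d → ℝ, MeasurableSet {p : (Fin n → Fin d → ℝ) × (Fin n → ℝ) × U |
      l2norm (β - h (p.1, (Matrix.of p.1).mulVec β + p.2.1, p.2.2)) < Δ / 2 ∧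
        ∀ j, |((Matrix.of p.1).mulVec β + p.2.1) j| ≤ B} := by
    intro β
    refine MeasurableSet.inter ?_ ?_
    · refine measurableSet_lt (measurable_l2norm.comp (measurable_const.sub (hh.comp ?_)))
        measurable_const
      exact measurable_fst.prodMk ((hy β).prodMk (by fun_prop))
    · exact hy β (measurableSet_cube B)
  refine sum_prod_le_of_forall _ _ F _ (fun β _ => hm β) fun X => ?_
  -- Reordering puts the internal randomness before the noise, so that it can be frozen too.
  have hswap : ∀ S : Set ((Fin n → ℝ) × U), MeasurableSet S →
      ((noiseLaw n σ).prod ν) S = (ν.prod (noiseLaw n σ)) (Prod.swap ⁻¹' S) := fun S hS =>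
    (Measure.measurePreserving_swap.measure_preimage hS.nullMeasurableSet).symm
  rw [Finset.sum_congr rfl fun β _ => hswap _ (measurable_prodMk_left (hm β))]
  refine sum_prod_le_of_forall _ _ F _
    (fun β _ => measurable_swap (measurable_prodMk_left (hm β))) fun u => ?_
  refine sum_noiseLaw_preimage_le hσ hB F (fun β => (Matrix.of X).mulVec β)
    (fun β => {y | l2norm (β - h (X, y, u)) < Δ / 2 ∧ ∀ j, |y j| ≤ B}) ?_ ?_ ?_
  · intro β _
    refine MeasurableSet.inter ?_ ?_
    · exact measurableSet_lt (measurable_l2norm.comp (measurable_const.sub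
        (hh.comp (by fun_prop)))) measurable_const
    · exact measurableSet_cube B
  · exact (pairwiseDisjoint_of_separated hF (fun y => h (X, y, u))).mono
      fun β y hy => hy.1
  · exact fun β _ y hy => hy.2

end Decoding

/-! ### From counting and volume bounds to failure probabilities -/

section LowerBounds

variable {n d : ℕ} {U : Type} [MeasurableSpace U] (ν : Measure U) [IsProbabilityMeasure ν]
  {σ C C₀ Δ T R : ℝ} {F : Set (Fin d → ℝ)} {f : (Fin n → ℝ) → (Fin n → ℝ)}

/-- Without measurements there is no noise and nothing is recovered within it. -/
lemma failureProb_eq_one_of_isEmpty [IsEmpty (Fin n)] (hF : F.Finite) (hne : F.Nonempty)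
    (est : (Fin n → Fin d → ℝ) × (Fin n → ℝ) × U → (Fin d → ℝ)) :
    failureProb F σ C f ν est = 1 := by
  have := isProbabilityMeasure_uniformOn hF hne
  have h0 : ∀ e : Fin n → ℝ, l2norm e = 0 := fun e => by
    simpa using l2norm_sq e
  have : IsProbabilityMeasure (jointLaw n F σ ν) := by unfold jointLaw; infer_instance
  simp [failureProb, h0, l2norm_nonneg]

/-- Success forces either large noise or decoding within `Δ/2`; `hnum` budgets the Chebyshev term
and the at most `K` fibres of equal norm. -/
lemma failureProb_ge_of_card_norms (hF : F.Finite) (hne : F.Nonempty)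
    (hsep : F.Pairwise fun β β' => Δ ≤ l2norm (β - β')) (hC : 0 < C) (hC₀ : C ≤ C₀) (hT : 0 < T)
    (hTΔ : C₀ * T ≤ Δ / 2) {K : ℕ}
    (hK : (hF.toFinset.image fun β => ∑ i, β i ^ 2).card ≤ K)
    (hnum : F.ncard * (n * σ ^ 2 / T ^ 2) + K ≤ 9 / 10 * F.ncard)
    (hf : Measurable f) {est : (Fin n → ℝ) × U → (Fin d → ℝ)} (hest : Measurable est) :
    1 / 10 ≤ failureProb F σ C f ν (fun p => est p.2) := by
  refine failureProb_ge ν σ hF hne hf (hest.comp measurable_snd) ?_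
  set κ := (designLaw n d).prod ((noiseLaw n σ).prod ν)
  have hsep' : (hF.toFinset : Set (Fin d → ℝ)).Pairwise fun β β' => Δ ≤ l2norm (β - β') := by
    simpa using hsep
  have key := sum_decoding_le_card_image ν σ (n := n) hsep' (h := fun q => est (f q.1, q.2))
    (hest.comp ((hf.comp measurable_fst).prodMk measurable_snd))
  have hstep : ∀ β ∈ hF.toFinset,
      κ {p | l2norm (β - est (observation f p.1 β p.2.1, p.2.2)) < C * l2norm p.2.1} ≤
        ENNReal.ofReal (n * σ ^ 2 / T ^ 2) +
        κ {p | l2norm (β - est (f ((Matrix.of p.1).mulVec β + p.2.1), p.2.2)) < Δ / 2} := by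
    intro β _
    refine le_trans (measure_mono ?_) ((measure_union_le _ _).trans
      (add_le_add_left (measure_le_l2norm_noise ν σ hT) _))
    intro p hp
    by_cases h : T ≤ l2norm p.2.1
    · exact Or.inl h
    · refine Or.inr ?_
      push Not at h
      change l2norm (β - est (f ((Matrix.of p.1).mulVec β + p.2.1), p.2.2)) < Δ / 2
      refine lt_of_lt_of_le hp ?_
      calc C * l2norm p.2.1 ≤ C₀ * T := by
            have := l2norm_nonneg p.2.1
            gcongr
            exact hC.le.trans hC₀
        _ ≤ _ := hTΔ
  refine (Finset.sum_le_sum hstep).trans ?_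
  rw [Finset.sum_add_distrib, Finset.sum_const, ← Set.ncard_eq_toFinset_card F hF, nsmul_eq_mul]
  calc _ ≤ (F.ncard : ENNReal) * ENNReal.ofReal (n * σ ^ 2 / T ^ 2) + (K : ENNReal) :=
        add_le_add_right (key.trans (by exact_mod_cast hK)) _
    _ = ENNReal.ofReal (F.ncard * (n * σ ^ 2 / T ^ 2) + K) := by
        rw [ENNReal.ofReal_add (by positivity) (by positivity), ENNReal.ofReal_mul (by positivity),
          ENNReal.ofReal_natCast, ENNReal.ofReal_natCast]
    _ ≤ _ := ENNReal.ofReal_le_ofReal hnum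

/-- Compared with the previous bound there is one more exceptional event, `R ≤ ‖X β‖`. Off both
events each coordinate of the observation is below `R + T ≤ 2R`, the half-side of the cube. -/
lemma failureProb_ge_of_volume (hσ : 0 < σ) (hF : F.Finite) (hne : F.Nonempty)
    (hsep : F.Pairwise fun β β' => Δ ≤ l2norm (β - β')) (hC : 0 < C) (hC₀ : C ≤ C₀) (hT : 0 < T)
    (hTΔ : C₀ * T ≤ Δ / 2) (hR : T ≤ R) {V : ℝ} (hV0 : 0 ≤ V) (hV : ∀ β ∈ F, ∑ i, β i ^ 2 ≤ V)
    (hnum : F.ncard * (n * σ ^ 2 / T ^ 2) + F.ncard * (n * V / R ^ 2) + (2 * R / σ) ^ n ≤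
      9 / 10 * F.ncard)
    (hf : Measurable f) {est : (Fin n → Fin d → ℝ) × (Fin n → ℝ) × U → (Fin d → ℝ)}
    (hest : Measurable est) :
    1 / 10 ≤ failureProb F σ C f ν est := by
  refine failureProb_ge ν σ hF hne hf hest ?_
  have hR0 : 0 < R := hT.trans_le hR
  set κ := (designLaw n d).prod ((noiseLaw n σ).prod ν)
  have hsep' : (hF.toFinset : Set (Fin d → ℝ)).Pairwise fun β β' => Δ ≤ l2norm (β - β') := by
    simpa using hsep
  have key := sum_decoding_le_volume ν (n := n) hsep' (h := fun q => est (q.1, f q.2.1, q.2.2))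
    (hest.comp (measurable_fst.prodMk ((hf.comp (measurable_fst.comp measurable_snd)).prodMk
      (measurable_snd.comp measurable_snd)))) hσ (B := 2 * R) (by positivity)
  have hstep : ∀ β ∈ hF.toFinset,
      κ {p | l2norm (β - est (p.1, observation f p.1 β p.2.1, p.2.2)) < C * l2norm p.2.1} ≤
        ENNReal.ofReal (n * σ ^ 2 / T ^ 2) + (ENNReal.ofReal (n * V / R ^ 2) +
        κ {p | l2norm (β - est (p.1, f ((Matrix.of p.1).mulVec β + p.2.1), p.2.2)) < Δ / 2 ∧
          ∀ j, |((Matrix.of p.1).mulVec β + p.2.1) j| ≤ 2 * R}) := by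
    intro β hβ
    have hsig : κ {p | R ≤ l2norm ((Matrix.of p.1).mulVec β)} ≤
        ENNReal.ofReal (n * V / R ^ 2) := by
      refine (measure_le_l2norm_mulVec ν σ β hR0).trans (ENNReal.ofReal_le_ofReal ?_)
      gcongr
      exact hV β (by simpa using hβ)
    refine le_trans (measure_mono ?_) ((measure_union_le _ _).trans
      (add_le_add (measure_le_l2norm_noise ν σ hT)
        ((measure_union_le _ _).trans (add_le_add_left hsig _))))
    intro p hp
    by_cases h : T ≤ l2norm p.2.1
    · exact Or.inl h
    by_cases h' : R ≤ l2norm ((Matrix.of p.1).mulVec β)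
    · exact Or.inr (Or.inl h')
    push Not at h h'
    refine Or.inr (Or.inr ⟨lt_of_lt_of_le hp ?_, fun j => ?_⟩)
    · calc C * l2norm p.2.1 ≤ C₀ * T := by
            have := l2norm_nonneg p.2.1
            gcongr
            exact hC.le.trans hC₀
        _ ≤ _ := hTΔ
    · have h1 := abs_apply_le_l2norm ((Matrix.of p.1).mulVec β) j
      have h2 := abs_apply_le_l2norm p.2.1 j
      have h3 := abs_add_le ((Matrix.of p.1).mulVec β j) (p.2.1 j)
      simp only [Pi.add_apply]
      linarith
  refine (Finset.sum_le_sum hstep).trans ?_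
  rw [Finset.sum_add_distrib, Finset.sum_add_distrib, Finset.sum_const, Finset.sum_const,
    ← Set.ncard_eq_toFinset_card F hF, nsmul_eq_mul, nsmul_eq_mul, ← add_assoc]
  calc _ ≤ (F.ncard : ENNReal) * ENNReal.ofReal (n * σ ^ 2 / T ^ 2) +
        F.ncard * ENNReal.ofReal (n * V / R ^ 2) + ENNReal.ofReal ((2 * R / σ) ^ n) :=
        add_le_add_right key _
    _ = ENNReal.ofReal (F.ncard * (n * σ ^ 2 / T ^ 2) + F.ncard * (n * V / R ^ 2) +
        (2 * R / σ) ^ n) := by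
        rw [ENNReal.ofReal_add (by positivity) (by positivity),
          ENNReal.ofReal_add (by positivity) (by positivity), ENNReal.ofReal_mul (by positivity),
          ENNReal.ofReal_mul (by positivity), ENNReal.ofReal_natCast]
    _ ≤ _ := ENNReal.ofReal_le_ofReal hnum

end LowerBounds

/-! ### Two weights, decoders that do not see `X` -/

section TwoWeights

variable {C₀ σ : ℝ} {d s : ℕ} {G : SimpleGraph (Fin d)} {r : Fin d}

lemma twoWeights_half (C₀ σ : ℝ) (d : ℕ) :
    twoWeights C₀ σ (1 / 2) d =
      {C₀ * σ * √d, C₀ * σ * √d + C₀ * σ * √d * √2} := by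
  have h1 : √(2 * (1 - 1 / 2 : ℝ)) = 1 := by norm_num
  have h2 : √(1 - 1 / 2 : ℝ) = (√2)⁻¹ := by rw [← Real.sqrt_inv]; norm_num
  rw [twoWeights, h1, h2, div_one, div_inv_eq_mul]

lemma card_twoWeights_half (hC₀ : 0 < C₀) (hσ : 0 < σ) (hd : 0 < d) :
    (twoWeights C₀ σ (1 / 2) d).card = 2 := by
  rw [twoWeights_half]
  refine Finset.card_pair (ne_of_lt ?_)
  have : 0 < C₀ * σ * √d * √2 := by positivity
  linarith

lemma twoWeights_half_separated (hC₀ : 0 < C₀) (hσ : 0 < σ) :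
    ∀ a ∈ insert 0 (twoWeights C₀ σ (1 / 2) d), ∀ b ∈ insert 0 (twoWeights C₀ σ (1 / 2) d),
      a ≠ b → C₀ * σ * √d ≤ |a - b| := by
  have h2 : 1 ≤ √2 := Real.one_le_sqrt.2 (by norm_num)
  rw [twoWeights_half]
  set w := C₀ * σ * √d with hw
  have hw0 : 0 ≤ w := by positivity
  have hw2 : w ≤ w * √2 := le_mul_of_one_le_right hw0 h2
  intro a ha b hb hab
  simp only [Finset.mem_insert, Finset.mem_singleton] at ha hb
  rw [le_abs]
  rcases ha with rfl | rfl | rfl <;> rcases hb with rfl | rfl | rfl <;>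
    first
      | exact absurd rfl hab
      | (left; linarith)
      | (right; linarith)

/-- The squared norm is determined by how many of the `s` support entries equal `a`, a number
between 0 and `s`. -/
lemma card_image_norm_ensemble_le (a b : ℝ) (hF : (ensemble G r s {a, b}).Finite) :
    (hF.toFinset.image fun β => ∑ i, β i ^ 2).card ≤ s + 1 := by
  classical
  have hsub : (hF.toFinset.image fun β => ∑ i, β i ^ 2) ⊆
      (Finset.range (s + 1)).image fun k : ℕ => k * a ^ 2 + ((s : ℝ) - k) * b ^ 2 := by
    intro v hv
    obtain ⟨β, hβ, rfl⟩ := Finset.mem_image.1 hv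
    obtain ⟨S, ⟨hS, -, -⟩, h0, hW⟩ := hF.mem_toFinset.1 hβ
    refine Finset.mem_image.2 ⟨(S.filter fun i => β i = a).card, ?_, ?_⟩
    · have := Finset.card_filter_le S fun i => β i = a
      simp
      omega
    · have h1 : ∑ i, β i ^ 2 = ∑ i ∈ S, β i ^ 2 :=
        (Finset.sum_subset (Finset.subset_univ S) fun i _ hi => by simp [h0 i hi]).symm
      have h2 : ∀ i ∈ S, β i ^ 2 = if β i = a then a ^ 2 else b ^ 2 := by
        intro i hi
        split_ifs with h
        · rw [h]
        · have := hW i hi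
          simp only [Finset.mem_insert, Finset.mem_singleton, h, false_or] at this
          rw [this]
      have h3 := Finset.card_filter_add_card_filter_not (s := S) fun i => β i = a
      rw [hS] at h3
      rw [h1, Finset.sum_congr rfl h2, Finset.sum_ite, Finset.sum_const, Finset.sum_const,
        nsmul_eq_mul, nsmul_eq_mul, ← h3]
      push_cast
      ring
  exact (Finset.card_le_card hsub).trans (Finset.card_image_le.trans (by simp))

lemma ten_mul_succ_le_two_pow (hs : 7 ≤ s) : 10 * (s + 1) ≤ 2 ^ s := by
  induction s, hs using Nat.le_induction with
  | base => norm_num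
  | succ k _ ih => rw [pow_succ]; omega

lemma mul_log_two_le_log_ncard_ensemble (hG : G.Connected) (hC₀ : 0 < C₀) (hσ : 0 < σ)
    (h1 : 1 ≤ s) (hd : s ≤ d) :
    Real.log 2 * s ≤ Real.log ((ensemble G r s (twoWeights C₀ σ (1 / 2) d)).ncard : ℝ) := by
  have h := pow_le_ncard_ensemble (r := r) (W := twoWeights C₀ σ (1 / 2) d) hG h1 hd
  rw [card_twoWeights_half hC₀ hσ (h1.trans hd)] at h
  rw [mul_comm, ← Real.log_pow]
  exact Real.log_le_log (by positivity) (by exact_mod_cast h)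

lemma ensemble_nonempty (hG : G.Connected) {W : Finset ℝ} (hW : W.Nonempty) (h1 : 1 ≤ s)
    (hd : s ≤ d) : (ensemble G r s W).Nonempty := by
  refine (Set.ncard_pos ensemble_finite).1 ?_
  exact (pow_pos hW.card_pos s).trans_le (pow_le_ncard_ensemble hG h1 hd)

lemma failureProb_twoWeights_ge {n : ℕ} (hG : G.Connected) (hC₀ : 0 < C₀) (hσ : 0 < σ)
    (h1 : 1 ≤ s) (hd : s ≤ d) (hn : 40 * n ≤ s) {f : (Fin n → ℝ) → (Fin n → ℝ)}
    (hf : Measurable f) {U : Type} [MeasurableSpace U] (ν : Measure U) [IsProbabilityMeasure ν]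
    {est : (Fin n → ℝ) × U → (Fin d → ℝ)} (hest : Measurable est) {C : ℝ} (hC : 0 < C)
    (hCC₀ : C ≤ C₀) :
    1 / 10 ≤ failureProb (ensemble G r s (twoWeights C₀ σ (1 / 2) d)) σ C f ν
      (fun p => est p.2) := by
  have hfin : (ensemble G r s (twoWeights C₀ σ (1 / 2) d)).Finite := ensemble_finite
  have hd0 : (0 : ℝ) < d := by exact_mod_cast h1.trans hd
  have hcard := card_twoWeights_half (d := d) hC₀ hσ (h1.trans hd)
  have hne : (ensemble G r s (twoWeights C₀ σ (1 / 2) d)).Nonempty :=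
    ensemble_nonempty hG (Finset.card_pos.1 (by omega)) h1 hd
  -- For `n = 0` the sparsity may be too small for `10 (s + 1) ≤ 2 ^ s`; a positive `n` forces `s ≥
  -- 40`.
  rcases Nat.eq_zero_or_pos n with rfl | hn0
  · rw [failureProb_eq_one_of_isEmpty ν hfin hne]
    simp
  have hN := pow_le_ncard_ensemble (r := r) (W := twoWeights C₀ σ (1 / 2) d) hG h1 hd
  rw [hcard] at hN
  -- With this `T`, `C₀ T = Δ/2` exactly and the Chebyshev term is `4n/d ≤ 1/10`; the norms cost
  -- another tenth.
  refine failureProb_ge_of_card_norms ν hfin hne (Δ := C₀ * σ * √d) (T := σ * √d / 2)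
    (ensemble_separated (twoWeights_half_separated hC₀ hσ)) hC hCC₀ (by positivity)
    (le_of_eq (by ring)) (K := s + 1) ?_ ?_ hf hest
  · revert hfin
    rw [twoWeights_half]
    exact fun hfin => card_image_norm_ensemble_le _ _ hfin
  · set N := (ensemble G r s (twoWeights C₀ σ (1 / 2) d)).ncard
    have hK : (10 * (s + 1 : ℕ) : ℝ) ≤ N := by
      exact_mod_cast (ten_mul_succ_le_two_pow (by omega)).trans hN
    have hq : n * σ ^ 2 / (σ * √d / 2) ^ 2 ≤ 1 / 10 := by
      rw [div_pow, mul_pow, Real.sq_sqrt hd0.le, div_le_iff₀ (by positivity)]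
      have : (40 * n : ℝ) ≤ d := by exact_mod_cast hn.trans hd
      nlinarith [sq_pos_of_pos hσ]
    have hN0 : (0 : ℝ) ≤ N := Nat.cast_nonneg _
    nlinarith

end TwoWeights

/-! ### Many weights, decoders that see `X` -/

section GridWeights

/-- The number of weights used against decoders that know the design matrix. -/
@[irreducible] def gridSize (C₀ : ℝ) (d : ℕ) : ℕ := d + ⌈C₀⌉₊ + 10

/-- Equally spaced weights; so many of them that `o(s)` measurements cannot resolve them. -/
def gridWeights (C₀ σ : ℝ) (d : ℕ) : Finset ℝ :=
  (Finset.Icc 1 (gridSize C₀ d)).image fun j : ℕ => C₀ * σ * (d + 1) * j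

variable {C₀ σ : ℝ} {d s : ℕ} {G : SimpleGraph (Fin d)} {r : Fin d}

lemma card_gridWeights (hC₀ : 0 < C₀) (hσ : 0 < σ) :
    (gridWeights C₀ σ d).card = gridSize C₀ d := by
  rw [gridWeights, Finset.card_image_of_injective, Nat.card_Icc, Nat.add_sub_cancel]
  intro i j h
  have : C₀ * σ * (d + 1) ≠ 0 := by positivity
  exact_mod_cast mul_left_cancel₀ this h

lemma zero_notMem_gridWeights (hC₀ : 0 < C₀) (hσ : 0 < σ) : 0 ∉ gridWeights C₀ σ d := by
  intro h
  obtain ⟨j, hj, h0⟩ := Finset.mem_image.1 h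
  have : 0 < j := (Finset.mem_Icc.1 hj).1
  have : 0 < C₀ * σ * (d + 1) * j := by positivity
  linarith

lemma exists_of_mem_insert_gridWeights {a : ℝ} (ha : a ∈ insert 0 (gridWeights C₀ σ d)) :
    ∃ j : ℕ, j ≤ gridSize C₀ d ∧ a = C₀ * σ * (d + 1) * j := by
  rcases Finset.mem_insert.1 ha with rfl | ha
  · exact ⟨0, by simp, by simp⟩
  · obtain ⟨j, hj, rfl⟩ := Finset.mem_image.1 ha
    exact ⟨j, (Finset.mem_Icc.1 hj).2, rfl⟩

lemma gridWeights_separated (hC₀ : 0 < C₀) (hσ : 0 < σ) :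
    ∀ a ∈ insert 0 (gridWeights C₀ σ d), ∀ b ∈ insert 0 (gridWeights C₀ σ d),
      a ≠ b → C₀ * σ * (d + 1) ≤ |a - b| := by
  intro a ha b hb hab
  obtain ⟨i, -, rfl⟩ := exists_of_mem_insert_gridWeights ha
  obtain ⟨j, -, rfl⟩ := exists_of_mem_insert_gridWeights hb
  have hij : (i : ℤ) - j ≠ 0 := by
    rintro h
    have : i = j := by omega
    exact hab (by rw [this])
  have h1 : (1 : ℝ) ≤ |(i : ℝ) - j| := by exact_mod_cast Int.one_le_abs hij
  rw [← mul_sub, abs_mul, abs_of_pos (by positivity : 0 < C₀ * σ * (d + 1))]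
  exact le_mul_of_one_le_right (by positivity) h1

lemma failureProb_gridWeights_ge {n : ℕ} (hG : G.Connected) (hC₀ : 0 < C₀) (hσ : 0 < σ)
    (h1 : 1 ≤ s) (hd : s ≤ d) (hn : 40 * n ≤ s) {f : (Fin n → ℝ) → (Fin n → ℝ)}
    (hf : Measurable f) {U : Type} [MeasurableSpace U] (ν : Measure U) [IsProbabilityMeasure ν]
    {est : (Fin n → Fin d → ℝ) × (Fin n → ℝ) × U → (Fin d → ℝ)} (hest : Measurable est) {C : ℝ}
    (hC : 0 < C) (hCC₀ : C ≤ C₀) :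
    1 / 10 ≤ failureProb (ensemble G r s (gridWeights C₀ σ d)) σ C f ν est := by
  have hfin : (ensemble G r s (gridWeights C₀ σ d)).Finite := ensemble_finite
  have hcard := card_gridWeights (d := d) hC₀ hσ
  have hN := pow_le_ncard_ensemble (r := r) (W := gridWeights C₀ σ d) hG h1 hd
  rw [hcard] at hN
  obtain ⟨m, hm⟩ : ∃ m, m = gridSize C₀ d := ⟨_, rfl⟩
  rw [← hm] at hcard hN
  have hm10 : 10 ≤ m := by simp [hm, gridSize]
  have hne : (ensemble G r s (gridWeights C₀ σ d)).Nonempty :=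
    ensemble_nonempty hG (Finset.card_pos.1 (by omega)) h1 hd
  have hdm : ((d : ℝ) + 1) ≤ m := by
    have : d + 1 ≤ m := by rw [hm, gridSize]; omega
    exact_mod_cast this
  have hCm : C₀ ≤ m := (Nat.le_ceil C₀).trans (by
    have : ⌈C₀⌉₊ ≤ m := by simp only [hm, gridSize]; omega
    exact_mod_cast this)
  have hm10' : (10 : ℝ) ≤ m := by exact_mod_cast hm10
  have hnm : (n : ℝ) ≤ m := by
    have : (n : ℝ) ≤ d := by exact_mod_cast (by omega : n ≤ d)
    linarith
  -- As `d + 1`, `C₀` and `n` are at most `m`, squared norms are at most `σ² m^7`. This `R` makes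
  -- the signal tail at most `4/m² ≤ 1/10` and the volume term `m^(5n)`.
  refine failureProb_ge_of_volume ν hσ hfin hne (Δ := C₀ * σ * (d + 1)) (T := σ * (d + 1) / 2)
    (R := σ * m ^ 5 / 2) (V := σ ^ 2 * m ^ 7)
    (ensemble_separated (gridWeights_separated hC₀ hσ)) hC hCC₀ (by positivity)
    (le_of_eq (by ring)) ?_ (by positivity) ?_ ?_ hf hest
  · have : (m : ℝ) ≤ (m : ℝ) ^ 5 := le_self_pow₀ (by linarith) (by norm_num)
    gcongr
    linarith
  · intro β hβ
    calc ∑ i, β i ^ 2 ≤ ∑ _i : Fin d, (C₀ * σ * (d + 1) * m) ^ 2 := by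
          refine Finset.sum_le_sum fun i _ => ?_
          obtain ⟨j, hj, h⟩ :=
            exists_of_mem_insert_gridWeights (apply_mem_insert_of_mem_ensemble hβ i)
          rw [← hm] at hj
          rw [h]
          gcongr
      _ = d * (C₀ * σ * (d + 1) * m) ^ 2 := by simp
      _ ≤ m * (m * σ * m * m) ^ 2 := by
          gcongr
          exact_mod_cast (by linarith : (d : ℝ) ≤ m)
      _ = _ := by ring
  · set N := (ensemble G r s (gridWeights C₀ σ d)).ncard
    have hN0 : (0 : ℝ) ≤ N := Nat.cast_nonneg _
    have hq : n * σ ^ 2 / (σ * (d + 1) / 2) ^ 2 ≤ 1 / 10 := by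
      rw [div_le_iff₀ (by positivity)]
      have h40 : (40 * n : ℝ) ≤ d + 1 := by exact_mod_cast (by omega : 40 * n ≤ d + 1)
      have h40' : (40 * n : ℝ) ≤ (d + 1) ^ 2 := by nlinarith [(Nat.cast_nonneg d : (0:ℝ) ≤ d)]
      nlinarith [sq_pos_of_pos hσ]
    have hq' : n * (σ ^ 2 * m ^ 7) / (σ * m ^ 5 / 2) ^ 2 ≤ 1 / 10 := by
      rw [div_le_iff₀ (by positivity)]
      calc n * (σ ^ 2 * m ^ 7) ≤ m * (σ ^ 2 * m ^ 7) := by gcongr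
        _ = σ ^ 2 * m ^ 8 := by ring
        _ ≤ σ ^ 2 * m ^ 8 * (m ^ 2 / 40) := by
          refine le_mul_of_one_le_right (by positivity) ?_
          nlinarith
        _ = _ := by ring
    have hv : (2 * (σ * m ^ 5 / 2) / σ) ^ n ≤ 1 / 10 * (N : ℝ) := by
      have e1 : 2 * (σ * (m : ℝ) ^ 5 / 2) / σ = m ^ 5 := by field_simp
      rw [e1, ← pow_mul]
      -- The spare factor `m ≥ 10` supplies the tenth. The exponent fits also for `n = 0`, because
      -- `1 ≤ s`.
      have h2 : (m : ℝ) ^ (5 * n + 1) ≤ m ^ s := pow_le_pow_right₀ (by linarith) (by omega)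
      have h3 : (m : ℝ) ^ s ≤ N := by exact_mod_cast hN
      have h4 : (10 : ℝ) * m ^ (5 * n) ≤ m ^ (5 * n + 1) := by
        rw [pow_succ, mul_comm]
        gcongr
      linarith
    nlinarith

end GridWeights

lemma eventually_mul_le_of_isLittleO {s n : ℕ → ℕ}
    (h : (fun k => (n k : ℝ)) =o[atTop] (fun k => (s k : ℝ))) :
    ∀ᶠ k in atTop, 40 * n k ≤ s k := by
  filter_upwards [h.def (by norm_num : (0 : ℝ) < 1 / 40)] with k hk
  simp only [Real.norm_natCast] at hk
  have : (40 * n k : ℝ) ≤ s k := by linarith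
  exact_mod_cast this

end TreeSparsity

end

theorem mainTheorem3 :
    ∃ ε ∈ Set.Ioo (0 : ℝ) 1, ∃ c : ℝ, 0 < c ∧ ∀ C₀ σ : ℝ, 0 < C₀ → 0 < σ →
      -- the size of the ensemble
      (∀ (d s : ℕ), 1 ≤ s → s ≤ d →
        ∀ (G : SimpleGraph (Fin d)) (r : Fin d), TreeSparsity.IsBinaryTree G r →
          c * (s : ℝ) ≤ Real.log
            ((TreeSparsity.ensemble G r s (TreeSparsity.twoWeights C₀ σ ε d)).ncard : ℝ)) ∧
      -- two explicit weights, procedures that see the observations `z`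
      (∀ s d n : ℕ → ℕ, (∀ k, 1 ≤ s k ∧ s k ≤ d k) →
        (fun k => (n k : ℝ)) =o[atTop] (fun k => (s k : ℝ)) →
        ∀ᶠ k in atTop, ∀ (G : SimpleGraph (Fin (d k))) (r : Fin (d k)),
          TreeSparsity.IsBinaryTree G r →
          ∀ f : (Fin (n k) → ℝ) → (Fin (n k) → ℝ), Measurable f →
          ∀ (U : Type) [MeasurableSpace U] (ν : Measure U) [IsProbabilityMeasure ν]
            (est : (Fin (n k) → ℝ) × U → (Fin (d k) → ℝ)), Measurable est →
          ∀ C : ℝ, 0 < C → C ≤ C₀ →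
            (1 / 10 : ENNReal) ≤ TreeSparsity.failureProb
              (TreeSparsity.ensemble G r (s k) (TreeSparsity.twoWeights C₀ σ ε (d k)))
              σ C f ν (fun p => est p.2)) ∧
      -- a particular set of weights, procedures that see both `X` and `z`
      (∃ W : ℕ → ℕ → Finset ℝ, (∀ d s, (W d s).Nonempty ∧ (0 : ℝ) ∉ W d s) ∧
        ∀ s d n : ℕ → ℕ, (∀ k, 1 ≤ s k ∧ s k ≤ d k) →
        (fun k => (n k : ℝ)) =o[atTop] (fun k => (s k : ℝ)) →
        ∀ᶠ k in atTop, ∀ (G : SimpleGraph (Fin (d k))) (r : Fin (d k)),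
          TreeSparsity.IsBinaryTree G r →
          ∀ f : (Fin (n k) → ℝ) → (Fin (n k) → ℝ), Measurable f →
          ∀ (U : Type) [MeasurableSpace U] (ν : Measure U) [IsProbabilityMeasure ν]
            (est : (Fin (n k) → Fin (d k) → ℝ) × (Fin (n k) → ℝ) × U → (Fin (d k) → ℝ)),
            Measurable est →
          ∀ C : ℝ, 0 < C → C ≤ C₀ →
            (1 / 10 : ENNReal) ≤ TreeSparsity.failureProb
              (TreeSparsity.ensemble G r (s k) (W (d k) (s k))) σ C f ν est) := by
  -- The choice `ε = 1/2` turns the weights into `w` and `w + w√2` with `w = C₀σ√d`, so that 0 and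
  -- the two weights are `w`-separated; `c = log 2` comes from the two choices per support node.
  refine ⟨1 / 2, by norm_num, Real.log 2, Real.log_pos (by norm_num), fun C₀ σ hC₀ hσ =>
    ⟨?_, ?_, ?_⟩⟩
  · exact fun d s h1 hd G r hG =>
      TreeSparsity.mul_log_two_le_log_ncard_ensemble hG.isTree.connected hC₀ hσ h1 hd
  · intro s d n hsd hn
    filter_upwards [TreeSparsity.eventually_mul_le_of_isLittleO hn] with k hk
    intro G r hG f hf U _ ν _ est hest C hC hCC₀
    exact TreeSparsity.failureProb_twoWeights_ge hG.isTree.connected hC₀ hσ (hsd k).1 (hsd k).2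
      hk hf ν hest hC hCC₀
  · refine ⟨fun d _ => TreeSparsity.gridWeights C₀ σ d, fun d _ => ⟨?_,
      TreeSparsity.zero_notMem_gridWeights hC₀ hσ⟩, ?_⟩
    · refine Finset.card_pos.1 ?_
      rw [TreeSparsity.card_gridWeights hC₀ hσ, TreeSparsity.gridSize]
      omega
    · intro s d n hsd hn
      filter_upwards [TreeSparsity.eventually_mul_le_of_isLittleO hn] with k hk
      intro G r hG f hf U _ ν _ est hest C hC hCC₀
      exact TreeSparsity.failureProb_gridWeights_ge hG.isTree.connected hC₀ hσ (hsd k).1 (hsd k).2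
        hk hf ν hest hC hCC₀
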